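/- Throughout, $R$ is a field of characteristic $p\ge 0$, $n,m\ge 1$ are integers, and $\sigma\in\Sigma_n$, $\tau\in\Sigma_m$ are permutations with cycle types $\lambda=(\lambda_1,\dots,\lambda_s)$ and $\mu=(\mu_1,\dots,\mu_t)$ (fixed points are counted as parts equal to $1$). Let $S_n(\sigma,R)$ be the $R$-algebra of all matrices $(a_{ij})\in M_n(R)$ with $a_{ij}=a_{\sigma(i),\sigma(j)}$ for all $i,j$. For a partition $\lambda$ with $s\ge 1$ parts put $d_\lambda=\gcd(\lambda_1,\dots,\lambda_s)$, $$g_i(\lambda)=\sum_{1\le j_1<\cdots<j_i\le s}\gcd(\lambda_{j_1},\dots,\lambda_{j_i})\quad(1\le i\le s),\qquad \epsilon_\lambda(x)=\sum_{i=0}^{s-1}(-1)^{s-1-i}\,\frac{g_{i+1}(\lambda)}{g_s(\lambda)}\,x^i\in\mathbb Z[x];$$ $\epsilon_\lambda$ is called the partition polynomial of $\lambda$. **Theorem 1.1.** (1) $S_n(\sigma,R)$ is semisimple if and only if $p\nmid\lambda_i$ for all $1\le i\le s$. (2) Assume that $R$ is algebraically closed, that $p\nmid\lambda_i$ for all $1\le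 i\le s$, and that $p\nmid\mu_j$ for all $1\le j\le t$. Then (i) $S_n(\sigma,R)\cong S_m(\tau,R)$ as $R$-algebras if and only if $m=n$ and $\epsilon_\lambda(x)=\epsilon_\mu(x)$. (ii) $S_n(\sigma,R)$ and $S_m(\tau,R)$ are Morita equivalent (that is, their module categories are equivalent as $R$-linear categories) if and only if $$(-1)^{s-1}d_\lambda\,\epsilon_\lambda(1)=(-1)^{t-1}d_\mu\,\epsilon_\mu(1).$$ -/

import Mathlib

/-- The `σ`-invariant matrix algebra `S_n(σ, R)`: all `n × n` matrices `a` over `R` with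
`a (σ i) (σ j) = a i j` for all `i`, `j`. -/
def invariantAlgebra (R : Type*) [CommRing R] {n : ℕ} (σ : Equiv.Perm (Fin n)) :
    Subalgebra R (Matrix (Fin n) (Fin n) R) where
  carrier := {a | ∀ i j, a i j = a (σ i) (σ j)}
  mul_mem' := by
    intro a b ha hb i j
    simp only [Matrix.mul_apply]
    rw [← Equiv.sum_comp σ (fun k => a (σ i) k * b k (σ j))]
    exact Finset.sum_congr rfl fun k _ => by rw [ha i k, hb k j]
  add_mem' := by
    intro a b ha hb i j
    simp only [Matrix.add_apply]
    rw [ha i j, hb i j]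
  algebraMap_mem' := by
    intro r i j
    simp [Matrix.algebraMap_matrix_apply]

namespace Nat.Partition

/-- The number `s` of parts of a partition, counted with multiplicity. -/
def numParts {n : ℕ} (l : n.Partition) : ℕ := Multiset.card l.parts

/-- The greatest common divisor `d_l` of the parts of a partition. -/
def gcdParts {n : ℕ} (l : n.Partition) : ℕ := l.parts.gcd

/-- The `i`-th elementary symmetric function of the parts, with products replaced by greatest
common divisors: `g_i(l)` is the sum of `gcd (l_{j_1}, …, l_{j_i})` over all
`j_1 < ⋯ < j_i`. -/
def gcdEsymm {n : ℕ} (l : n.Partition) (i : ℕ) : ℕ :=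
  ((l.parts.powersetCard i).map Multiset.gcd).sum

/-- The partition polynomial
`ε_l(x) = ∑_{i=0}^{s-1} (-1)^(s-1-i) (g_{i+1}(l) / g_s(l)) x^i`, an integral polynomial;
the division is exact, see `gcdEsymm_numParts_dvd`. -/
noncomputable def partitionPolynomial {n : ℕ} (l : n.Partition) : Polynomial ℤ :=
  ∑ i ∈ Finset.range l.numParts,
    Polynomial.C ((-1) ^ (l.numParts - 1 - i) *
      ((l.gcdEsymm (i + 1) / l.gcdEsymm l.numParts : ℕ) : ℤ)) * Polynomial.X ^ i

theorem gcdEsymm_numParts {n : ℕ} (l : n.Partition) :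
    l.gcdEsymm l.numParts = l.gcdParts := by
  simp [gcdEsymm, numParts, gcdParts, Multiset.powersetCard_self]

theorem gcdEsymm_numParts_dvd {n : ℕ} (l : n.Partition) (i : ℕ) :
    l.gcdEsymm l.numParts ∣ l.gcdEsymm i := by
  rw [gcdEsymm_numParts]
  refine Multiset.dvd_sum fun x hx => ?_
  obtain ⟨t, ht, rfl⟩ := Multiset.mem_map.1 hx
  exact Multiset.gcd_mono (Multiset.subset_of_le (Multiset.mem_powersetCard.1 ht).1)

end Nat.Partition

/-! `invariantAlgebra R σ` is the centralizer of the permutation operator f : v ↦ v ∘ σ on R^n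
(`mem_invariantAlgebra_iff_commute`).

If p divides no part, f is annihilated by the separable polynomial X^N - 1, N the product of the
orbit lengths, so f is semisimple and its centralizer, the endomorphism ring of a semisimple
R[X]-module, is semisimple. If p divides a part, then σ has order pN for some N, and f^N - 1 is a
nonzero central nilpotent of the centralizer.

Over an algebraically closed field f is diagonalizable, so the algebra is a product of matrix
algebras, one per eigenvalue ζ, of size d_ζ = #{orbits q : ζ^|q| = 1}. Counting pairs (ζ, T), with T
a set of i orbits and ζ^gcd(T) = 1, gives ∑_ζ C(d_ζ, i) = g_i for i ≥ 1 (`sum_choose_eigenDim`).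
These binomial sums determine the multiset of block sizes, which classifies the algebra up to
isomorphism, and they carry the same information as n together with ε. Morita equivalence sees only
the number of blocks, and inclusion–exclusion gives ∑_i (-1)^i g_{i+1} = (-1)^(s-1) d ε(1) for that
number (`card_eigenvalues`). -/

/-! ### Orbit lengths and eigenspaces of a permutation operator. -/

open Finset in
theorem Equiv.Perm.minimalPeriod_eq_card_support_cycleOf {α : Type*} [Fintype α] [DecidableEq α]
    (σ : Equiv.Perm α) {x : α} (hx : σ x ≠ x) :
    Function.minimalPeriod σ x = #(σ.cycleOf x).support := by
  have key (k : ℕ) : Function.minimalPeriod σ x ∣ k ↔ #(σ.cycleOf x).support ∣ k := by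
    rw [← Function.isPeriodicPt_iff_minimalPeriod_dvd, Function.IsPeriodicPt,
      Function.IsFixedPt, Equiv.Perm.iterate_eq_pow]
    have h := (σ.isCycleOn_support_cycleOf x).pow_apply_eq (n := k)
      (Equiv.Perm.mem_support_cycleOf_iff.2 ⟨Equiv.Perm.SameCycle.refl _ _,
        Equiv.Perm.mem_support.2 hx⟩)
    exact h
  exact Nat.dvd_antisymm ((key _).2 dvd_rfl) ((key _).1 dvd_rfl)

namespace Equiv.Perm

/-- The orbits of a permutation, fixed points included. -/
abbrev Orbits {α : Type*} (σ : Equiv.Perm α) : Type _ := Quotient (SameCycle.setoid σ)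

noncomputable instance {α : Type*} [Fintype α] (σ : Equiv.Perm α) : Fintype σ.Orbits :=
  Fintype.ofFinite _

/-- The number of elements of an orbit of a permutation. -/
noncomputable def Orbits.length {α : Type*} {σ : Equiv.Perm α} (q : σ.Orbits) : ℕ :=
  Function.minimalPeriod σ q.out

theorem sameCycle_out_mk {α : Type*} (σ : Equiv.Perm α) (x : α) :
    σ.SameCycle (Quotient.out (Quotient.mk (SameCycle.setoid σ) x)) x :=
  Quotient.exact (Quotient.out_eq (Quotient.mk (SameCycle.setoid σ) x))

end Equiv.Perm

/-- The parts of the cycle partition of a permutation are the lengths of its orbits. -/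
theorem Equiv.Perm.partition_parts_eq_map_minimalPeriod {α : Type*} [Fintype α] [DecidableEq α]
    (σ : Equiv.Perm α) :
    σ.partition.parts = (Finset.univ : Finset σ.Orbits).val.map Orbits.length := by
  classical
  have hout := σ.sameCycle_out_mk
  set Q := σ.Orbits
  have hsplit : (Finset.univ : Finset Q).val =
      (Finset.univ.filter fun q : Q => σ q.out ≠ q.out).val +
      (Finset.univ.filter fun q : Q => ¬ σ q.out ≠ q.out).val := by
    rw [Finset.filter_val, Finset.filter_val]
    exact (Multiset.filter_add_not _ _).symm
  -- Nontrivial orbits account for `cycleType`, fixed points for the added parts equal to 1.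
  rw [parts_partition, hsplit, Multiset.map_add]
  congr 1
  · have himg : σ.cycleFactorsFinset =
        (Finset.univ.filter fun q : Q => σ q.out ≠ q.out).image fun q => σ.cycleOf q.out := by
      ext c
      simp only [Finset.mem_image, Finset.mem_filter, Finset.mem_univ, true_and]
      constructor
      · intro hc
        obtain ⟨x, hx⟩ := (mem_cycleFactorsFinset_iff.1 hc).1.nonempty_support
        have hcx := cycle_is_cycleOf hx hc
        have hxσ : x ∈ σ.support := mem_cycleFactorsFinset_support_le hc hx
        refine ⟨Quotient.mk _ x, ?_, ?_⟩
        · rw [← mem_support]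
          exact (hout x).mem_support_iff.2 hxσ
        · rw [hcx]
          exact (hout x).cycleOf_eq
      · rintro ⟨q, hq, rfl⟩
        exact cycleOf_mem_cycleFactorsFinset_iff.2 (mem_support.2 hq)
    rw [cycleType_def, himg, Finset.image_val_of_injOn, Multiset.map_map]
    · refine Multiset.map_congr rfl fun q hq => ?_
      have hq' : σ q.out ≠ q.out := (Finset.mem_filter.1 hq).2
      exact (σ.minimalPeriod_eq_card_support_cycleOf hq').symm
    · intro q hq q' hq' h
      have hq1 : σ q.out ≠ q.out := (Finset.mem_filter.1 hq).2
      have := (sameCycle_iff_cycleOf_eq_of_mem_support (mem_support.2 hq1)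
        (mem_support.2 (Finset.mem_filter.1 hq').2)).2 h
      rw [← Quotient.out_eq q, ← Quotient.out_eq q']
      exact Quotient.sound this
  · have hfix : (Finset.univ.filter fun q : Q => ¬ σ q.out ≠ q.out).card =
        Fintype.card α - σ.support.card := by
      rw [← Finset.card_compl]
      refine Finset.card_bij (fun q _ => q.out) ?_ ?_ ?_
      · intro q hq
        simpa using hq
      · intro q _ q' _ h
        rw [← Quotient.out_eq q, h, Quotient.out_eq]
      · intro x hx
        have hx : σ x = x := by simpa using hx
        have h := (hout x).symm.eq_of_left hx
        refine ⟨Quotient.mk _ x, ?_, h.symm⟩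
        simp only [Finset.mem_filter, Finset.mem_univ, true_and, not_not]
        rw [← h]
        exact hx
    rw [← hfix]
    symm
    refine Multiset.eq_replicate.2 ⟨by rw [Multiset.card_map, Finset.card_val], fun a ha => ?_⟩
    obtain ⟨q, hq, rfl⟩ := Multiset.mem_map.1 ha
    have hq' : ¬ σ q.out ≠ q.out := (Finset.mem_filter.1 hq).2
    exact Function.minimalPeriod_eq_one_iff_isFixedPt.2 (not_not.1 hq')

namespace Equiv.Perm

theorem length_mem_partition_parts {α : Type*} [Fintype α] [DecidableEq α] {σ : Equiv.Perm α}
    (q : σ.Orbits) : q.length ∈ σ.partition.parts := by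
  rw [partition_parts_eq_map_minimalPeriod]
  exact Multiset.mem_map_of_mem _ (Finset.mem_univ_val q)

/-- Makes the eigenvector with value ζ^k at σ^k x well defined on the orbit of x. -/
theorem pow_eq_pow_of_pow_apply_eq {α R : Type*} [Finite α] [Monoid R] (σ : Equiv.Perm α)
    {x : α} {ζ : R} (hζ : ζ ^ Function.minimalPeriod σ x = 1) {k l : ℕ}
    (h : (σ ^ k) x = (σ ^ l) x) : ζ ^ k = ζ ^ l := by
  have hpos : 0 < Function.minimalPeriod σ x :=
    Function.minimalPeriod_pos_of_mem_periodicPts (σ.injective.mem_periodicPts x)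
  have h' : σ^[k] x = σ^[l] x := by simpa only [iterate_eq_pow] using h
  rw [← Function.iterate_mod_minimalPeriod_eq, ← Function.iterate_mod_minimalPeriod_eq (n := l)] at h'
  rw [pow_eq_pow_mod k hζ, pow_eq_pow_mod l hζ, Function.iterate_injOn_Iio_minimalPeriod
    (Nat.mod_lt _ hpos) (Nat.mod_lt _ hpos) h']

theorem pow_length_out {α : Type*} {σ : Equiv.Perm α} (q : σ.Orbits) :
    (σ ^ q.length) q.out = q.out := by
  rw [← iterate_eq_pow]
  exact Function.isPeriodicPt_minimalPeriod _ _

open scoped Classical in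
/-- The `ζ`-eigenspace of the permutation operator `v ↦ v ∘ σ` has one dimension for each orbit
whose length is a multiple of the order of `ζ`. -/
theorem finrank_eigenspace_funLeft {α R : Type*} [Fintype α] [Field R]
    (σ : Equiv.Perm α) (ζ : R) :
    Module.finrank R (Module.End.eigenspace (LinearMap.funLeft R R σ) ζ) =
      (Finset.univ.filter fun q : σ.Orbits => ζ ^ q.length = 1).card := by
  have hmem (v : α → R) : v ∈ Module.End.eigenspace (LinearMap.funLeft R R σ) ζ ↔
      ∀ x, v (σ x) = ζ * v x := by
    rw [Module.End.mem_eigenspace_iff, funext_iff]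
    rfl
  have hpow {v : α → R} (hv : ∀ x, v (σ x) = ζ * v x) (k : ℕ) (x : α) :
      v ((σ ^ k) x) = ζ ^ k * v x := by
    induction k with
    | zero => simp
    | succ k ih => rw [pow_succ', mul_apply, hv, ih, pow_succ', mul_assoc]
  -- An eigenvector is determined by its values at orbit representatives; going once around an orbit
  -- multiplies by ζ^length, so it vanishes there unless that power is 1.
  let ev : Module.End.eigenspace (LinearMap.funLeft R R σ) ζ →ₗ[R]
      ({q : σ.Orbits // ζ ^ q.length = 1} → R) :=
    { toFun := fun v q => v.1 q.1.out
      map_add' := fun _ _ => rfl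
      map_smul' := fun _ _ => rfl }
  have hinj : Function.Injective ev := by
    rw [injective_iff_map_eq_zero]
    rintro ⟨v, hv⟩ h
    rw [hmem] at hv
    ext x
    obtain ⟨k, hk⟩ := (σ.sameCycle_out_mk x).exists_nat_pow_eq
    change v x = 0
    rw [← hk, hpow hv]
    by_cases hq : ζ ^ Orbits.length (Quotient.mk (SameCycle.setoid σ) x) = 1
    · have : v (Quotient.out (Quotient.mk (SameCycle.setoid σ) x)) = 0 :=
        congrFun h ⟨_, hq⟩
      simp [this]
    · have h1 := hpow hv (Orbits.length (Quotient.mk (SameCycle.setoid σ) x))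
        (Quotient.out (Quotient.mk (SameCycle.setoid σ) x))
      rw [pow_length_out] at h1
      have : v (Quotient.out (Quotient.mk (SameCycle.setoid σ) x)) = 0 := by
        by_contra hne
        exact hq (mul_right_cancel₀ hne (h1.symm.trans (one_mul _).symm))
      simp [this]
  have hsurj : Function.Surjective ev := by
    intro u
    choose k hk using fun x => (σ.sameCycle_out_mk x).exists_nat_pow_eq
    let v : α → R := fun x =>
      if h : ζ ^ Orbits.length (Quotient.mk (SameCycle.setoid σ) x) = 1 then
        ζ ^ k x * u ⟨_, h⟩ else 0
    have hv : ∀ x, v (σ x) = ζ * v x := by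
      intro x
      have hmk : Quotient.mk (SameCycle.setoid σ) (σ x) = Quotient.mk (SameCycle.setoid σ) x :=
        Quotient.sound (sameCycle_apply_left.2 (SameCycle.refl _ _))
      by_cases h : ζ ^ Orbits.length (Quotient.mk (SameCycle.setoid σ) x) = 1
      · have h2 := hk (σ x)
        simp only [v, hmk, dif_pos h, ← mul_assoc, ← pow_succ'] at h2 ⊢
        congr 1
        refine pow_eq_pow_of_pow_apply_eq σ h ?_
        rw [h2, pow_succ', mul_apply, hk]
      · simp only [v, hmk, dif_neg h, mul_zero]
    refine ⟨⟨v, (hmem v).2 hv⟩, funext fun q => ?_⟩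
    obtain ⟨q, hq⟩ := q
    have hmk : Quotient.mk (SameCycle.setoid σ) q.out = q := Quotient.out_eq q
    have h2 := hk q.out
    change v q.out = _
    simp only [v, hmk, dif_pos hq] at h2 ⊢
    have : ζ ^ k q.out = ζ ^ 0 := pow_eq_pow_of_pow_apply_eq σ hq (by rw [h2]; rfl)
    rw [this, pow_zero, one_mul]
  rw [(LinearEquiv.ofBijective ev ⟨hinj, hsurj⟩).finrank_eq, Module.finrank_fintype_fun_eq_card,
    Fintype.card_subtype]

end Equiv.Perm

/-! ### Semisimple centralizers and central nilpotents. -/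

/-- The centralizer of a semisimple endomorphism of a finite-dimensional space is semisimple. -/
theorem Module.End.IsSemisimple.isSemisimpleRing_centralizer {K V : Type*} [Field K]
    [AddCommGroup V] [Module K V] [Module.Finite K V] {f : Module.End K V} (hf : f.IsSemisimple) :
    IsSemisimpleRing (Subalgebra.centralizer K {f}) := by
  have : IsSemisimpleModule (Polynomial K) (Module.AEval' f) := hf
  have := IsSemisimpleRing.moduleEnd (Polynomial K) (Module.AEval' f)
  let o := Module.AEval'.of f
  let toEnd : Module.End (Polynomial K) (Module.AEval' f) →+* Module.End K V :=
    { toFun := fun g => o.symm.toLinearMap ∘ₗ g.restrictScalars K ∘ₗ o.toLinearMap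
      map_one' := by ext v; simp
      map_mul' := fun g h => by ext v; simp
      map_zero' := by ext v; simp
      map_add' := fun g h => by ext v; simp }
  have hmem (g) : toEnd g ∈ Subalgebra.centralizer K {f} := by
    rw [Subalgebra.mem_centralizer_iff]
    intro f' hf'
    rw [Set.mem_singleton_iff.1 hf']
    ext v
    change f (o.symm (g (o v))) = o.symm (g (o (f v)))
    rw [← Module.AEval'.of_symm_X_smul, ← Module.AEval'.X_smul_of]
    exact congrArg o.symm (g.map_smul Polynomial.X (o v)).symm
  refine RingHom.isSemisimpleRing_of_surjective
    (toEnd.codRestrict (Subalgebra.centralizer K {f}) hmem) ?_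
  rintro ⟨a, ha⟩
  have ha' : f * a = a * f := (Subalgebra.mem_centralizer_iff K).1 ha f rfl
  refine ⟨LinearMap.ofAEval f (o.toLinearMap ∘ₗ a) fun v => ?_, ?_⟩
  · change o (a (f v)) = Polynomial.X • o (a v)
    rw [Module.AEval'.X_smul_of]
    exact congrArg o (LinearMap.congr_fun ha' v).symm
  · refine Subtype.ext (LinearMap.ext fun v => ?_)
    change o.symm (o (a (o.symm (o v)))) = a v
    simp

/-- A central nilpotent element of a semisimple ring is zero. -/
theorem IsSemisimpleRing.eq_zero_of_isNilpotent_of_commute {A : Type*} [Ring A]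
    [IsSemisimpleRing A] {z : A} (hz : IsNilpotent z) (hcomm : ∀ a, Commute a z) : z = 0 := by
  obtain ⟨e, he, hI⟩ := IsSemisimpleRing.ideal_eq_span_idempotent (Ideal.span {z})
  obtain ⟨b, hb⟩ := Ideal.mem_span_singleton'.1 (hI ▸ Ideal.mem_span_singleton_self e)
  obtain ⟨a, ha⟩ := Ideal.mem_span_singleton'.1 (hI ▸ Ideal.mem_span_singleton_self z)
  obtain ⟨k, hk⟩ := hz
  -- Write e = b z with z central: then e = e^(k+1) = b^(k+1) z^(k+1) = 0.
  have he0 : e = 0 := by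
    rw [← he.pow_succ_eq k, ← hb, (hcomm b).mul_pow, pow_succ z, hk, zero_mul, mul_zero]
  rw [← ha, he0, mul_zero]

/-- By Frobenius, (F^N - 1)^p = F^(Np) - 1 = 0, so F^N - 1 is a central nilpotent. -/
theorem IsSemisimpleRing.pow_eq_one_of_pow_mul_eq_one {R A : Type*} [Field R] [Ring A] [Algebra R A]
    [IsSemisimpleRing A] (p : ℕ) [Fact p.Prime] [CharP R p] {F : A} (hF : ∀ a, Commute a F)
    {N : ℕ} (h : F ^ (N * p) = 1) : F ^ N = 1 := by
  nontriviality A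
  have : CharP A p := charP_of_injective_algebraMap (algebraMap R A).injective p
  refine sub_eq_zero.1 (IsSemisimpleRing.eq_zero_of_isNilpotent_of_commute ⟨p, ?_⟩
    fun g => ((hF g).pow_right N).sub_right (Commute.one_right g))
  rw [sub_pow_char_of_commute p (Commute.one_right _), ← pow_mul, h, one_pow, sub_self]

/-! ### The invariant algebra as a centralizer; the semisimplicity criterion. -/

section InvariantAlgebra

variable {R : Type*} [Field R] {n : ℕ} (σ : Equiv.Perm (Fin n))

theorem funLeft_pow (k : ℕ) :
    (LinearMap.funLeft R R σ : Module.End R (Fin n → R)) ^ k = LinearMap.funLeft R R (σ ^ k) := by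
  induction k with
  | zero => rfl
  | succ k ih => rw [pow_succ', ih]; rfl

/-- The operator sends the basis vector at σ j to the one at j; comparing the two products there
gives the defining equations. -/
theorem mem_invariantAlgebra_iff_commute {a : Matrix (Fin n) (Fin n) R} :
    a ∈ invariantAlgebra R σ ↔
      Commute (LinearMap.funLeft R R σ : Module.End R (Fin n → R)) (Matrix.toLinAlgEquiv' a) := by
  have hleft (i j : Fin n) : ((LinearMap.funLeft R R σ : Module.End R (Fin n → R)) *
      Matrix.toLinAlgEquiv' a) (Pi.single (σ j) 1) i = a (σ i) (σ j) := by
    simp [LinearMap.funLeft_apply]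
  have hright (i j : Fin n) : (Matrix.toLinAlgEquiv' a *
      (LinearMap.funLeft R R σ : Module.End R (Fin n → R))) (Pi.single (σ j) 1) i = a i j := by
    have : LinearMap.funLeft R R σ (Pi.single (σ j) (1 : R)) = Pi.single j 1 := by
      ext k
      simp [LinearMap.funLeft_apply, Pi.single_apply]
    rw [Module.End.mul_apply, this]
    simp
  constructor
  · intro ha
    refine LinearMap.pi_ext' fun j => ?_
    obtain ⟨j, rfl⟩ := σ.surjective j
    ext i
    exact (hleft i j).trans ((ha i j).symm.trans (hright i j).symm)
  · intro h i j
    rw [← hright i j, ← hleft i j, h.eq]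

/-- The invariant matrix algebra is the centralizer of the permutation operator. -/
noncomputable def invariantAlgebraEquivCentralizer : invariantAlgebra R σ ≃ₐ[R]
    Subalgebra.centralizer R {(LinearMap.funLeft R R σ : Module.End R (Fin n → R))} :=
  ((Matrix.toLinAlgEquiv' (R := R) (n := Fin n)).subalgebraMap (invariantAlgebra R σ)).trans
    (Subalgebra.equivOfEq _ _ (by
      ext g
      rw [Subalgebra.mem_map, Subalgebra.mem_centralizer_iff]
      constructor
      · rintro ⟨a, ha, rfl⟩ _ rfl
        exact (mem_invariantAlgebra_iff_commute σ).1 ha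
      · intro h
        refine ⟨Matrix.toLinAlgEquiv'.symm g, (mem_invariantAlgebra_iff_commute σ).2 ?_, ?_⟩
        · rw [AlgEquiv.apply_symm_apply]
          exact h _ rfl
        · exact AlgEquiv.apply_symm_apply _ g))

theorem pow_length_mk (x : Fin n) :
    (σ ^ Equiv.Perm.Orbits.length (Quotient.mk (Equiv.Perm.SameCycle.setoid σ) x)) x = x := by
  obtain ⟨k, hk⟩ := (σ.sameCycle_out_mk x).exists_nat_pow_eq
  generalize hq : Quotient.mk (Equiv.Perm.SameCycle.setoid σ) x = q at hk ⊢
  rw [← hk, ← Equiv.Perm.mul_apply, ← pow_add, add_comm, pow_add, Equiv.Perm.mul_apply,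
    Equiv.Perm.pow_length_out]

theorem pow_prod_length_eq_one : σ ^ (∏ q : σ.Orbits, q.length) = 1 := by
  ext x : 1
  obtain ⟨c, hc⟩ := Finset.dvd_prod_of_mem Equiv.Perm.Orbits.length
    (Finset.mem_univ (Quotient.mk (Equiv.Perm.SameCycle.setoid σ) x))
  rw [hc, pow_mul, Equiv.Perm.pow_apply_eq_self_of_apply_eq_self (pow_length_mk σ x)]
  rfl

theorem natCast_length_ne_zero {σ : Equiv.Perm (Fin n)}
    (h : ∀ a ∈ σ.partition.parts, (a : R) ≠ 0) (q : σ.Orbits) : (q.length : R) ≠ 0 :=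
  h _ (Equiv.Perm.length_mem_partition_parts q)

/-- The exponent is the product of the orbit lengths, so that its nonvanishing in R, hence
separability, can be checked factor by factor. -/
theorem isSemisimple_funLeft (h : ∀ a ∈ σ.partition.parts, (a : R) ≠ 0) :
    Module.End.IsSemisimple (LinearMap.funLeft R R σ) := by
  refine Module.End.isSemisimple_of_squarefree_aeval_eq_zero
    (p := Polynomial.X ^ (∏ q : σ.Orbits, q.length) - 1) ?_ ?_
  · refine (Polynomial.X_pow_sub_one_separable_iff.2 ?_).squarefree
    rw [Nat.cast_prod, Finset.prod_ne_zero_iff]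
    exact fun q _ => natCast_length_ne_zero h q
  · rw [map_sub, map_pow, Polynomial.aeval_X, map_one, funLeft_pow, pow_prod_length_eq_one,
      sub_eq_zero]
    rfl

theorem isSemisimpleRing_invariantAlgebra (h : ∀ a ∈ σ.partition.parts, (a : R) ≠ 0) :
    IsSemisimpleRing (invariantAlgebra R σ) :=
  have := (isSemisimple_funLeft σ h).isSemisimpleRing_centralizer
  RingEquiv.isSemisimpleRing
    (R := Subalgebra.centralizer R {(LinearMap.funLeft R R σ : Module.End R (Fin n → R))})
    (invariantAlgebraEquivCentralizer σ).symm.toRingEquiv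

theorem natCast_ne_zero_of_isSemisimpleRing [IsSemisimpleRing (invariantAlgebra R σ)] {a : ℕ}
    (ha : a ∈ σ.partition.parts) : (a : R) ≠ 0 := by
  intro h0
  obtain ⟨p, hp⟩ := CharP.exists R
  have hpa : p ∣ a := (CharP.cast_eq_zero_iff R p a).1 h0
  have ha0 : a ≠ 0 := (σ.partition.parts_pos ha).ne'
  have hprime : p.Prime := (CharP.char_is_prime_or_zero R p).resolve_right
    fun h => ha0 (zero_dvd_iff.1 (h ▸ hpa))
  have : Fact p.Prime := ⟨hprime⟩
  have haN : a ∣ orderOf σ := by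
    rw [Equiv.Perm.partition_parts_eq_map_minimalPeriod] at ha
    obtain ⟨q, -, rfl⟩ := Multiset.mem_map.1 ha
    refine Function.IsPeriodicPt.minimalPeriod_dvd ?_
    rw [Function.IsPeriodicPt, Equiv.Perm.iterate_eq_pow, pow_orderOf_eq_one]
    rfl
  obtain ⟨N, hN⟩ := hpa.trans haN
  have hNpos : 0 < N := Nat.pos_of_ne_zero fun h => (orderOf_pos σ).ne' (by rw [hN, h, mul_zero])
  have hne : (σ ^ N) ≠ 1 :=
    pow_ne_one_of_lt_orderOf hNpos.ne' (by rw [hN]; exact lt_mul_left hNpos hprime.one_lt)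
  obtain ⟨f, hf⟩ : ∃ f : Module.End R (Fin n → R), f = LinearMap.funLeft R R σ := ⟨_, rfl⟩
  have hfpow (k : ℕ) : f ^ k = LinearMap.funLeft R R (σ ^ k) := by rw [hf, funLeft_pow]
  have hS : IsSemisimpleRing (Subalgebra.centralizer R {f}) := by
    rw [hf]
    exact RingEquiv.isSemisimpleRing (R := invariantAlgebra R σ)
      (invariantAlgebraEquivCentralizer σ).toRingEquiv
  have hfmem : f ∈ Subalgebra.centralizer R {f} := by
    rw [Subalgebra.mem_centralizer_iff]
    rintro _ rfl
    rfl
  have hpN : f ^ (N * p) = 1 := by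
    rw [hfpow, mul_comm, ← hN, pow_orderOf_eq_one]
    rfl
  have hFN := IsSemisimpleRing.pow_eq_one_of_pow_mul_eq_one (R := R) p
    (F := (⟨f, hfmem⟩ : Subalgebra.centralizer R {f}))
    (fun g => Subtype.ext ((Subalgebra.mem_centralizer_iff R).1 g.2 f rfl).symm)
    (N := N) (Subtype.ext hpN)
  have h1 : LinearMap.funLeft R R (σ ^ N) = (1 : Module.End R (Fin n → R)) := by
    rw [← hfpow]
    exact congrArg Subtype.val hFN
  -- The operator determines the permutation: test it on the indicator function of x.
  refine hne (Equiv.ext fun x => ?_)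
  have h2 := congrFun (LinearMap.congr_fun h1 (Pi.single x 1)) x
  by_contra hx
  simp [LinearMap.funLeft_apply, show (σ ^ N) x ≠ x from hx] at h2

end InvariantAlgebra

/-! ### Centralizers of diagonalizable endomorphisms. -/

namespace Matrix

variable {o R : Type*} {m' : o → Type*} [Fintype o] [DecidableEq o] [∀ i, Fintype (m' i)]
  [∀ i, DecidableEq (m' i)] [CommRing R]

variable (m' R) in
/-- `Matrix.blockDiagonal'` as an algebra homomorphism. -/
def blockDiagonalAlgHom :
    (∀ i, Matrix (m' i) (m' i) R) →ₐ[R] Matrix (Σ i, m' i) (Σ i, m' i) R :=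
  { blockDiagonal'RingHom m' R with
    commutes' := fun r => by
      ext ⟨i, a⟩ ⟨j, b⟩
      by_cases h : i = j
      · subst h
        simp [blockDiagonal'_apply, algebraMap_matrix_apply]
      · simp [blockDiagonal'_apply, algebraMap_matrix_apply, h] }

/-- The (i, j) block of the commutator is (χ i - χ j) times that of M, so commuting kills exactly
the off-diagonal blocks. -/
theorem mem_range_blockDiagonalAlgHom_iff_commute [IsDomain R] {χ : o → R}
    (hχ : Function.Injective χ) {M : Matrix (Σ i, m' i) (Σ i, m' i) R} :
    M ∈ (blockDiagonalAlgHom R m').range ↔ Commute (diagonal fun i => χ i.1) M := by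
  constructor
  · rintro ⟨a, rfl⟩
    ext ⟨i, x⟩ ⟨j, y⟩
    rw [diagonal_mul, mul_diagonal]
    by_cases h : i = j
    · subst h
      exact mul_comm _ _
    · change χ i * blockDiagonal' a _ _ = blockDiagonal' a _ _ * _
      simp [blockDiagonal'_apply, h]
  · intro h
    refine ⟨fun i => M.submatrix (Sigma.mk i) (Sigma.mk i), ?_⟩
    ext ⟨i, x⟩ ⟨j, y⟩
    change blockDiagonal' (fun i => M.submatrix (Sigma.mk i) (Sigma.mk i)) _ _ = _
    by_cases hij : i = j
    · subst hij
      simp [blockDiagonal'_apply]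
    · have h1 := congrFun (congrFun h.eq ⟨i, x⟩) ⟨j, y⟩
      rw [diagonal_mul, mul_diagonal, mul_comm, ← sub_eq_zero, ← mul_sub, mul_eq_zero,
        sub_eq_zero] at h1
      rw [h1.resolve_right fun h => hij (hχ h)]
      simp [blockDiagonal'_apply, hij]

end Matrix

namespace Module.End

variable {K V : Type*} [Field K] [AddCommGroup V] [Module K V]
  {f : Module.End K V}

theorem isInternal_eigenspace_eigenvalues [DecidableEq f.Eigenvalues]
    (hf : ⨆ μ : K, f.eigenspace μ = ⊤) :
    DirectSum.IsInternal fun μ : f.Eigenvalues => f.eigenspace μ := by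
  rw [DirectSum.isInternal_submodule_iff_iSupIndep_and_iSup_eq_top]
  refine ⟨f.eigenspaces_iSupIndep.comp Subtype.val_injective, ?_⟩
  rw [← hf]
  refine le_antisymm (iSup_le fun μ => le_iSup f.eigenspace (μ : K)) (iSup_le fun μ => ?_)
  by_cases h : f.HasEigenvalue μ
  · exact le_iSup (fun μ : f.Eigenvalues => f.eigenspace μ) ⟨μ, h⟩
  · rw [show f.eigenspace μ = ⊥ from not_not.1 fun hne => h (hasEigenvalue_iff.2 hne)]
    exact bot_le

/-- The centralizer of a diagonalizable endomorphism is a product of matrix algebras, one for each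
eigenvalue. -/
theorem exists_centralizer_algEquiv_pi_matrix [FiniteDimensional K V]
    (hf : ⨆ μ : K, f.eigenspace μ = ⊤) :
    Nonempty (Subalgebra.centralizer K {f} ≃ₐ[K]
      ∀ μ : f.Eigenvalues, Matrix (Fin (finrank K (f.eigenspace μ)))
        (Fin (finrank K (f.eigenspace μ))) K) := by
  classical
  let b := (isInternal_eigenspace_eigenvalues hf).collectedBasis
    fun μ => Module.finBasis K (f.eigenspace μ)
  let e := LinearMap.toMatrixAlgEquiv b
  have hb (i) : f (b i) = (i.1 : K) • b i := mem_eigenspace_iff.1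
    ((isInternal_eigenspace_eigenvalues hf).collectedBasis_mem _ i)
  have hef : e f = Matrix.diagonal fun i => (i.1 : K) := by
    ext i j
    rw [LinearMap.toMatrixAlgEquiv_apply, hb]
    by_cases h : i = j
    · subst h; simp
    · simp [Matrix.diagonal_apply_ne _ h, Ne.symm h]
  have hmap : (Subalgebra.centralizer K {f}).map (e : Module.End K V →ₐ[K] _) =
      (Matrix.blockDiagonalAlgHom K fun μ : f.Eigenvalues =>
        Fin (finrank K (f.eigenspace μ))).range := by
    ext M
    rw [Matrix.mem_range_blockDiagonalAlgHom_iff_commute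
      (χ := fun μ : f.Eigenvalues => (μ : K)) Subtype.val_injective, ← hef, Subalgebra.mem_map]
    constructor
    · rintro ⟨g, hg, rfl⟩
      exact Commute.map ((Subalgebra.mem_centralizer_iff K).1 hg f rfl) e
    · intro h
      refine ⟨e.symm M, (Subalgebra.mem_centralizer_iff K).2 fun f' hf' => ?_,
        e.apply_symm_apply M⟩
      rw [Set.mem_singleton_iff.1 hf']
      apply e.injective
      rw [map_mul, map_mul, e.apply_symm_apply]
      exact h.eq
  exact ⟨(e.subalgebraMap _).trans ((Subalgebra.equivOfEq _ _ hmap).trans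
    (AlgEquiv.ofInjective _ Matrix.blockDiagonal'_injective).symm)⟩

end Module.End

/-! ### Gcd sums and the partition polynomial. -/

namespace Nat.Partition

variable {n m : ℕ}

theorem gcdEsymm_one (l : n.Partition) : l.gcdEsymm 1 = n := by
  rw [gcdEsymm, Multiset.powersetCard_one, Multiset.map_map]
  simp [l.parts_sum]

theorem gcdEsymm_eq_zero_of_numParts_lt (l : n.Partition) {i : ℕ} (hi : l.numParts < i) :
    l.gcdEsymm i = 0 := by
  rw [gcdEsymm, Multiset.powersetCard_eq_empty i hi]
  rfl

theorem numParts_pos (l : n.Partition) (hn : 0 < n) : 0 < l.numParts := by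
  rw [numParts, Multiset.card_pos]
  intro h
  have := l.parts_sum
  rw [h, Multiset.sum_zero] at this
  omega

theorem gcdEsymm_numParts_pos (l : n.Partition) (hn : 0 < n) :
    0 < l.gcdEsymm l.numParts := by
  refine Nat.pos_of_ne_zero fun h => hn.ne' ?_
  have := l.gcdEsymm_numParts_dvd 1
  rwa [h, gcdEsymm_one, zero_dvd_iff] at this

theorem coeff_partitionPolynomial (l : n.Partition) (i : ℕ) :
    l.partitionPolynomial.coeff i = if i < l.numParts then (-1) ^ (l.numParts - 1 - i) *
      ((l.gcdEsymm (i + 1) / l.gcdEsymm l.numParts : ℕ) : ℤ) else 0 := by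
  rw [partitionPolynomial, Polynomial.finsetSum_coeff]
  simp only [Polynomial.coeff_C_mul_X_pow, Finset.sum_ite_eq, Finset.mem_range]

/-- The number of parts is the last index with a nonzero gcd sum. -/
theorem numParts_le_of_gcdEsymm_eq {l : n.Partition} {l' : m.Partition} (hn : 0 < n)
    (h : ∀ i, 1 ≤ i → l.gcdEsymm i = l'.gcdEsymm i) : l.numParts ≤ l'.numParts := by
  by_contra! hlt
  have h1 := l.gcdEsymm_numParts_pos hn
  rw [h _ (l.numParts_pos hn), l'.gcdEsymm_eq_zero_of_numParts_lt hlt] at h1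
  exact h1.false

/-- The partition polynomial has degree s - 1, with leading coefficient 1. -/
theorem numParts_le_of_partitionPolynomial_eq {l : n.Partition} {l' : m.Partition} (hn : 0 < n)
    (h : l.partitionPolynomial = l'.partitionPolynomial) : l.numParts ≤ l'.numParts := by
  by_contra! hlt
  have hs := l.numParts_pos hn
  have h1 := congrArg (fun P => P.coeff (l.numParts - 1)) h
  simp only [coeff_partitionPolynomial] at h1
  rw [if_pos (by omega), if_neg (by omega), Nat.sub_add_cancel hs,
    Nat.div_self (l.gcdEsymm_numParts_pos hn)] at h1
  simp at h1

/-- The size of a partition and its partition polynomial determine and are determined by the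
elementary symmetric gcd sums. -/
theorem gcdEsymm_eq_iff {l : n.Partition} {l' : m.Partition} (hn : 0 < n) (hm : 0 < m) :
    (∀ i, 1 ≤ i → l.gcdEsymm i = l'.gcdEsymm i) ↔
      m = n ∧ l.partitionPolynomial = l'.partitionPolynomial := by
  constructor
  · intro h
    have hs : l.numParts = l'.numParts := le_antisymm (numParts_le_of_gcdEsymm_eq hn h)
      (numParts_le_of_gcdEsymm_eq hm fun i hi => (h i hi).symm)
    refine ⟨by rw [← l.gcdEsymm_one, ← l'.gcdEsymm_one, h 1 le_rfl], ?_⟩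
    ext i
    rw [coeff_partitionPolynomial, coeff_partitionPolynomial, h _ (l.numParts_pos hn), hs,
      h _ (Nat.le_add_left 1 i)]
  · rintro ⟨rfl, h⟩ i hi
    have hs : l.numParts = l'.numParts := le_antisymm
      (numParts_le_of_partitionPolynomial_eq hn h)
      (numParts_le_of_partitionPolynomial_eq hm h.symm)
    have hdiv (j : ℕ) (hj : j < l.numParts) : l.gcdEsymm (j + 1) / l.gcdEsymm l.numParts =
        l'.gcdEsymm (j + 1) / l'.gcdEsymm l'.numParts := by
      have h1 := congrArg (fun P => P.coeff j) h
      simp only [coeff_partitionPolynomial] at h1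
      rw [if_pos hj, if_pos (hs ▸ hj), hs] at h1
      rw [hs]
      exact_mod_cast mul_left_cancel₀ (pow_ne_zero _ (by norm_num)) h1
    -- The constant coefficient is n / g_s up to sign; since n is common and positive, it determines
    -- g_s.
    have hg : l.gcdEsymm l.numParts = l'.gcdEsymm l'.numParts := by
      have h0 := hdiv 0 (l.numParts_pos hn)
      have h1 := Nat.div_mul_cancel (l.gcdEsymm_numParts_dvd 1)
      have h2 := Nat.div_mul_cancel (l'.gcdEsymm_numParts_dvd 1)
      rw [zero_add] at h0
      rw [← h0] at h2
      simp only [gcdEsymm_one] at h1 h2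
      refine Nat.eq_of_mul_eq_mul_left (Nat.pos_of_ne_zero fun h => ?_) (h1.trans h2.symm)
      rw [h, zero_mul] at h1
      omega
    obtain ⟨j, rfl⟩ : ∃ j, i = j + 1 := ⟨i - 1, by omega⟩
    by_cases hj : j < l.numParts
    · rw [← Nat.div_mul_cancel (l.gcdEsymm_numParts_dvd (j + 1)), hdiv j hj, hg,
        Nat.div_mul_cancel (l'.gcdEsymm_numParts_dvd (j + 1))]
    · rw [l.gcdEsymm_eq_zero_of_numParts_lt (by omega),
        l'.gcdEsymm_eq_zero_of_numParts_lt (by omega)]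

theorem neg_one_pow_mul_gcdParts_mul_eval_one (l : n.Partition) :
    (-1) ^ (l.numParts - 1) * (l.gcdParts : ℤ) * l.partitionPolynomial.eval 1 =
      ∑ i ∈ Finset.range l.numParts, (-1) ^ i * (l.gcdEsymm (i + 1) : ℤ) := by
  rw [partitionPolynomial, Polynomial.eval_finsetSum, Finset.mul_sum]
  refine Finset.sum_congr rfl fun i hi => ?_
  rw [Finset.mem_range] at hi
  simp only [Polynomial.eval_mul, Polynomial.eval_C, Polynomial.eval_pow, Polynomial.eval_X,
    one_pow, mul_one]
  have hsign : (-1 : ℤ) ^ (l.numParts - 1) * (-1) ^ (l.numParts - 1 - i) = (-1) ^ i := by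
    rw [← pow_add, show l.numParts - 1 + (l.numParts - 1 - i) =
      i + 2 * (l.numParts - 1 - i) by omega, pow_add, pow_mul]
    simp
  have hdiv : (l.gcdEsymm (i + 1) : ℤ) = (l.gcdParts : ℤ) *
      ((l.gcdEsymm (i + 1) / l.gcdEsymm l.numParts : ℕ) : ℤ) := by
    rw [← gcdEsymm_numParts, ← Nat.cast_mul, Nat.mul_div_cancel' (l.gcdEsymm_numParts_dvd _)]
  rw [hdiv, ← hsign]
  ring

end Nat.Partition

/-! ### Binomial sums. -/

/-- Two finite families of positive integers agree up to reindexing if and only if they have the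
same sums of binomial coefficients. -/
theorem exists_equiv_iff_sum_choose_eq {ι κ : Type*} [Fintype ι] [Fintype κ] {d : ι → ℕ}
    {e : κ → ℕ} (hd : ∀ i, 0 < d i) (he : ∀ j, 0 < e j) :
    (∃ φ : ι ≃ κ, ∀ i, e (φ i) = d i) ↔
      ∀ k, 1 ≤ k → ∑ i, (d i).choose k = ∑ j, (e j).choose k := by
  classical
  constructor
  · rintro ⟨φ, hφ⟩ k -
    rw [← φ.sum_comp]
    simp_rw [hφ]
  · intro h
    -- The k-th coefficient of ∑ (X+1)^(d i) is the k-th binomial sum. The constant term, the size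
    -- of the family, is not given and is subtracted.
    let P : Polynomial ℤ := ∑ i, (Polynomial.X + 1) ^ d i
    let Q : Polynomial ℤ := ∑ j, (Polynomial.X + 1) ^ e j
    have hPQ : P - Polynomial.C (P.coeff 0) = Q - Polynomial.C (Q.coeff 0) := by
      ext k
      rcases k with _ | k
      · simp
      · have := h (k + 1) (by omega)
        simp only [P, Q, Polynomial.coeff_sub, Polynomial.finsetSum_coeff,
          Polynomial.coeff_X_add_one_pow, Polynomial.coeff_C_succ, sub_zero]
        exact_mod_cast this
    -- Substituting X - 1 for X turns this into ∑ X^(d i), whose coefficients are multiplicities; k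
    -- = 0 is excluded by positivity.
    have hcount (k : ℕ) : Fintype.card {i // d i = k} = Fintype.card {j // e j = k} := by
      rcases k with _ | k
      · have : IsEmpty {i // d i = 0} := ⟨fun i => (hd i.1).ne' i.2⟩
        have : IsEmpty {j // e j = 0} := ⟨fun j => (he j.1).ne' j.2⟩
        simp
      · have h1 := congrArg (fun P : Polynomial ℤ =>
          (P.comp (Polynomial.X - 1)).coeff (k + 1)) hPQ
        simp only [P, Q, Polynomial.sub_comp, Polynomial.C_comp, Polynomial.coeff_sub,
          Polynomial.coeff_C_succ, sub_zero, Polynomial.sum_comp, Polynomial.pow_comp,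
          Polynomial.add_comp, Polynomial.X_comp, Polynomial.one_comp, sub_add_cancel,
          Polynomial.finsetSum_coeff, Polynomial.coeff_X_pow, Finset.sum_boole] at h1
        rw [Fintype.card_subtype, Fintype.card_subtype]
        simp only [eq_comm (a := k + 1)] at h1
        exact_mod_cast h1
    let φ : ι ≃ κ := (Equiv.sigmaFiberEquiv d).symm.trans ((Equiv.sigmaCongrRight fun k =>
      Fintype.equivOfCardEq (hcount k)).trans (Equiv.sigmaFiberEquiv e))
    exact ⟨φ, fun i => (Fintype.equivOfCardEq (hcount (d i)) ⟨i, rfl⟩).2⟩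

/-- Inclusion–exclusion for the constant one in terms of binomial coefficients. -/
theorem Int.sum_range_neg_one_pow_mul_choose_succ {d s : ℕ} (hd : 0 < d) (hds : d ≤ s) :
    ∑ i ∈ Finset.range s, (-1 : ℤ) ^ i * (d.choose (i + 1) : ℤ) = 1 := by
  have h : ∑ i ∈ Finset.range (s + 1), (-1 : ℤ) ^ i * (d.choose i : ℤ) = 0 := by
    rw [← Int.alternating_sum_range_choose_of_ne hd.ne']
    refine (Finset.sum_subset (Finset.range_mono (by omega)) fun i _ hi => ?_).symm
    rw [Nat.choose_eq_zero_of_lt (by simpa using hi)]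
    simp
  rw [Finset.sum_range_succ'] at h
  simp only [pow_succ, mul_neg, mul_one, neg_mul, Finset.sum_neg_distrib] at h
  simp at h
  omega

/-! ### Counting eigenvalues and eigenspace dimensions. -/

section Counting

variable {R : Type*} [Field R] {n : ℕ} (σ : Equiv.Perm (Fin n))

theorem numParts_partition_eq_card_orbits : σ.partition.numParts = Fintype.card σ.Orbits := by
  rw [Nat.Partition.numParts, Equiv.Perm.partition_parts_eq_map_minimalPeriod, Multiset.card_map]
  rfl

theorem gcdEsymm_partition (i : ℕ) : σ.partition.gcdEsymm i =
    ∑ T ∈ (Finset.univ : Finset σ.Orbits).powersetCard i, T.gcd Equiv.Perm.Orbits.length := by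
  rw [Nat.Partition.gcdEsymm, Equiv.Perm.partition_parts_eq_map_minimalPeriod,
    Multiset.powersetCard_map, ← Finset.map_val_val_powersetCard, Multiset.map_map,
    Multiset.map_map]
  rfl

/-- The source of the gcds: the conditions from all orbits of T merge into one. -/
theorem pow_gcd_eq_one_iff {ι : Type*} (T : Finset ι) (l : ι → ℕ) (ζ : R) :
    ζ ^ T.gcd l = 1 ↔ ∀ q ∈ T, ζ ^ l q = 1 := by
  simp only [← orderOf_dvd_iff_pow_eq_one, Finset.dvd_gcd_iff]

theorem card_nthRootsFinset_of_isAlgClosed [IsAlgClosed R] {k : ℕ} (hk : (k : R) ≠ 0) :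
    (Polynomial.nthRootsFinset k (1 : R)).card = k := by
  have : NeZero (k : R) := ⟨hk⟩
  obtain ⟨ζ, hζ⟩ := HasEnoughRootsOfUnity.exists_primitiveRoot R k
  exact hζ.card_nthRootsFinset

variable (R) in
/-- The dimension of an eigenspace of the permutation operator of `σ`. -/
noncomputable abbrev eigenDim
    (μ : Module.End.Eigenvalues (LinearMap.funLeft R R σ : Module.End R (Fin n → R))) : ℕ :=
  Module.finrank R (Module.End.eigenspace (LinearMap.funLeft R R σ : Module.End R (Fin n → R)) μ)

theorem eigenDim_pos (μ) : 0 < eigenDim R σ μ := by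
  have hμ : Module.End.HasEigenvalue (LinearMap.funLeft R R σ : Module.End R (Fin n → R)) μ := μ.2
  have := Submodule.nontrivial_iff_ne_bot.2 (Module.End.hasEigenvalue_iff.1 hμ)
  exact Module.finrank_pos

theorem eigenDim_le_numParts (μ) : eigenDim R σ μ ≤ σ.partition.numParts := by
  classical
  rw [eigenDim, Equiv.Perm.finrank_eigenspace_funLeft, numParts_partition_eq_card_orbits]
  exact Finset.card_le_univ _

/-- Double counting of pairs (μ, T) where μ is an eigenvalue and T a set of i orbits with μ^gcd(T) =
1. -/
theorem sum_choose_eigenDim [IsAlgClosed R] (h : ∀ a ∈ σ.partition.parts, (a : R) ≠ 0) {i : ℕ}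
    (hi : 1 ≤ i) : ∑ μ, (eigenDim R σ μ).choose i = σ.partition.gcdEsymm i := by
  classical
  let f : Module.End R (Fin n → R) := LinearMap.funLeft R R σ
  have hdim (μ : f.Eigenvalues) : (eigenDim R σ μ).choose i =
      ∑ T ∈ (Finset.univ : Finset σ.Orbits).powersetCard i,
        if (μ : R) ^ T.gcd Equiv.Perm.Orbits.length = 1 then 1 else 0 := by
    rw [eigenDim, Equiv.Perm.finrank_eigenspace_funLeft, ← Finset.card_powersetCard,
      Finset.sum_boole, Nat.cast_id]
    congr 1
    ext T
    simp only [Finset.mem_powersetCard, Finset.mem_filter, pow_gcd_eq_one_iff,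
      Finset.subset_iff, Finset.mem_univ, true_and, implies_true]
    tauto
  rw [gcdEsymm_partition, Finset.sum_congr rfl fun μ _ => hdim μ, Finset.sum_comm]
  refine Finset.sum_congr rfl fun T hT => ?_
  -- For i ≥ 1, T contains an orbit, so the gcd is nonzero in R and every root of unity of that
  -- exponent is an eigenvalue.
  obtain ⟨q, hq⟩ : T.Nonempty := Finset.card_pos.1 (by
    rw [(Finset.mem_powersetCard.1 hT).2]; exact hi)
  have hdvd := Finset.gcd_dvd (f := Equiv.Perm.Orbits.length) hq
  have hg : ((T.gcd Equiv.Perm.Orbits.length : ℕ) : R) ≠ 0 := by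
    obtain ⟨c, hc⟩ := hdvd
    intro h0
    exact natCast_length_ne_zero h q (by rw [hc, Nat.cast_mul, h0, zero_mul])
  have hg0 : 0 < T.gcd Equiv.Perm.Orbits.length :=
    Nat.pos_of_ne_zero fun h0 => hg (by rw [h0, Nat.cast_zero])
  rw [Finset.sum_boole, Nat.cast_id]
  refine Eq.trans ?_ (card_nthRootsFinset_of_isAlgClosed hg)
  refine Finset.card_bij (fun μ _ => (μ : R)) (fun μ hμ => ?_)
    (fun μ _ ν _ h => Subtype.ext h) fun ζ hζ => ?_
  · exact (Polynomial.mem_nthRootsFinset hg0 1).2 (Finset.mem_filter.1 hμ).2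
  · rw [Polynomial.mem_nthRootsFinset hg0] at hζ
    have hev : f.HasEigenvalue ζ := by
      rw [Module.End.hasEigenvalue_iff, ← Submodule.one_le_finrank_iff,
        Equiv.Perm.finrank_eigenspace_funLeft]
      refine Finset.card_pos.2 ⟨q, Finset.mem_filter.2 ⟨Finset.mem_univ q, ?_⟩⟩
      exact (pow_gcd_eq_one_iff T _ ζ).1 hζ q hq
    exact ⟨⟨ζ, hev⟩, Finset.mem_filter.2 ⟨Finset.mem_univ _, hζ⟩, rfl⟩

/-- Each eigenspace contributes 1 = ∑ (-1)^i C(d, i+1); s terms suffice because d ≤ s. -/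
theorem card_eigenvalues [IsAlgClosed R] (h : ∀ a ∈ σ.partition.parts, (a : R) ≠ 0) :
    (Fintype.card (Module.End.Eigenvalues
      (LinearMap.funLeft R R σ : Module.End R (Fin n → R))) : ℤ) =
      (-1) ^ (σ.partition.numParts - 1) * (σ.partition.gcdParts : ℤ) *
            σ.partition.partitionPolynomial.eval 1 := by
  rw [Nat.Partition.neg_one_pow_mul_gcdParts_mul_eval_one]
  simp_rw [← sum_choose_eigenDim σ h (Nat.le_add_left 1 _), Nat.cast_sum, Finset.mul_sum]
  rw [Finset.sum_comm, Finset.sum_congr rfl fun μ _ =>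
    Int.sum_range_neg_one_pow_mul_choose_succ (eigenDim_pos σ μ) (eigenDim_le_numParts σ μ)]
  simp

end Counting

/-! ### Primitive idempotents and uniqueness of the Wedderburn decomposition. -/

section PiIdempotents

variable {ι κ K : Type*} [DecidableEq ι] [DecidableEq κ] [Field K]

theorem Pi.single_one_mul_self (i : ι) :
    (Pi.single i 1 : ι → K) * Pi.single i 1 = Pi.single i 1 := by
  rw [← Pi.single_mul, one_mul]

theorem Pi.single_one_injective : Function.Injective fun i => (Pi.single i 1 : ι → K) := by
  intro i j h
  by_contra hij
  have := congrFun h i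
  simp [hij] at this

/-- The image is a nonzero idempotent, hence 1 at some j. The preimage of the j-th primitive
idempotent then lies under the i-th one and must equal it. Only multiplication is used, as that is
what the isomorphism of category centers supplies. -/
theorem exists_apply_single_of_pi_mulEquiv (ψ : (ι → K) ≃* (κ → K)) (i : ι) :
    ∃ j, ψ (Pi.single i 1) = Pi.single j 1 := by
  have hne : ψ (Pi.single i 1) ≠ 0 := by
    rw [Ne, map_eq_zero_iff ψ ψ.injective]
    exact Pi.single_ne_zero_iff.2 one_ne_zero
  obtain ⟨j, hj⟩ := Function.ne_iff.1 hne
  have he : ψ (Pi.single i 1) * ψ (Pi.single i 1) = ψ (Pi.single i 1) := by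
    rw [← map_mul, Pi.single_one_mul_self]
  have hj1 : ψ (Pi.single i 1) j = 1 :=
    mul_left_cancel₀ hj ((congrFun he j).trans (mul_one _).symm)
  refine ⟨j, ?_⟩
  obtain ⟨g, hg⟩ := ψ.surjective (Pi.single j 1)
  have hgi : g * Pi.single i 1 = g := by
    apply ψ.injective
    rw [map_mul, hg]
    ext k
    by_cases hk : k = j
    · subst hk; simp [hj1]
    · simp [hk]
  have hgg : g * g = g := by
    apply ψ.injective
    rw [map_mul, hg, Pi.single_one_mul_self]
  have hg0 (k : ι) (hk : k ≠ i) : g k = 0 := by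
    have := congrFun hgi k
    simpa [hk] using this.symm
  have hgi0 : g i ≠ 0 := by
    intro h0
    have : g = 0 := funext fun k => by
      by_cases hk : k = i
      · rw [hk, h0]; rfl
      · exact hg0 k hk
    rw [this, map_zero] at hg
    exact Pi.single_ne_zero_iff.2 (one_ne_zero (α := K)) hg.symm
  have hgi1 : g i = 1 := mul_left_cancel₀ hgi0 ((congrFun hgg i).trans (mul_one _).symm)
  have : g = Pi.single i 1 := funext fun k => by
    by_cases hk : k = i
    · subst hk; simp [hgi1]
    · simp [hk, hg0 k hk]
  rw [← hg, this]

/-- A multiplicative isomorphism between powers of a field is induced on the primitive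
idempotents by a bijection of the index types. -/
theorem exists_equiv_apply_single_of_pi_mulEquiv (ψ : (ι → K) ≃* (κ → K)) :
    ∃ φ : ι ≃ κ, ∀ i, ψ (Pi.single i 1) = Pi.single (φ i) 1 := by
  choose φ hφ using exists_apply_single_of_pi_mulEquiv ψ
  refine ⟨Equiv.ofBijective φ ⟨fun i i' h => ?_, fun j => ?_⟩, hφ⟩
  · apply Pi.single_one_injective (K := K)
    apply ψ.injective
    change ψ (Pi.single i 1) = ψ (Pi.single i' 1)
    rw [hφ, hφ, h]
  · obtain ⟨i, hi⟩ := exists_apply_single_of_pi_mulEquiv ψ.symm j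
    refine ⟨i, Pi.single_one_injective (K := K) ?_⟩
    change Pi.single (φ i) 1 = Pi.single j 1
    rw [← hφ, ← hi, ψ.apply_symm_apply]

end PiIdempotents

section PiMatrix

variable {K ι κ : Type*} [Field K] {d : ι → ℕ} {e : κ → ℕ}

variable (K d) in
/-- The product of the matrix algebras of sizes `d i` over `K`. -/
abbrev PiMatrix : Type _ := ∀ i, Matrix (Fin (d i)) (Fin (d i)) K

theorem mem_center_piMatrix_iff {x : PiMatrix K d} :
    x ∈ Submonoid.center (PiMatrix K d) ↔ ∃ c : ι → K, x = fun i => algebraMap K _ (c i) := by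
  rw [← SetLike.mem_coe, Submonoid.coe_center, Set.center_pi]
  simp only [Matrix.center_eq_range, Set.mem_pi, Set.mem_univ, true_imp_iff, Set.mem_range]
  rw [Classical.skolem]
  exact exists_congr fun c => ⟨fun h => funext fun i => (h i).symm, fun h i => (congrFun h i).symm⟩

variable (K) in
/-- The center of a product of nonzero matrix algebras over a field is a power of the field. -/
noncomputable def piMatrixCenterEquiv (hd : ∀ i, 0 < d i) :
    (ι → K) ≃* Submonoid.center (PiMatrix K d) :=
  MulEquiv.ofBijective (F := (ι → K) →* Submonoid.center (PiMatrix K d))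
    { toFun := fun c => (⟨fun i => algebraMap K _ (c i), mem_center_piMatrix_iff.2 ⟨c, rfl⟩⟩ :
        Submonoid.center (PiMatrix K d))
      map_one' := Subtype.ext (funext fun i => map_one _)
      map_mul' := fun b c => Subtype.ext (funext fun i => map_mul _ _ _) }
    ⟨fun b c h => funext fun i => by
      have := Fin.pos_iff_nonempty.1 (hd i)
      exact FaithfulSMul.algebraMap_injective K (Matrix (Fin (d i)) (Fin (d i)) K)
        (congrFun (congrArg Subtype.val h) i),
    fun x => by
      obtain ⟨c, hc⟩ := mem_center_piMatrix_iff.1 x.2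
      exact ⟨c, Subtype.ext hc.symm⟩⟩

/-- The subspace of elements fixed by left multiplication by a given element. -/
def mulLeftFixed (K : Type*) {A : Type*} [CommSemiring K] [Semiring A] [Algebra K A] (a : A) :
    Submodule K A :=
  LinearMap.eqLocus (LinearMap.mulLeft K a) LinearMap.id

/-- Reads off the block size from the algebra: a primitive central idempotent cuts out a block of
dimension (d i)². -/
theorem finrank_mulLeftFixed_single [DecidableEq ι] (i : ι) :
    Module.finrank K (mulLeftFixed K (fun j => algebraMap K _ ((Pi.single i 1 : ι → K) j) :
      PiMatrix K d)) = d i * d i := by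
  have hmem (x : PiMatrix K d) : x ∈ mulLeftFixed K (fun j => algebraMap K _
      ((Pi.single i 1 : ι → K) j) : PiMatrix K d) ↔ ∀ j, j ≠ i → x j = 0 := by
    constructor
    · intro h j hj
      have h1 : algebraMap K (Matrix (Fin (d j)) (Fin (d j)) K) ((Pi.single i 1 : ι → K) j) * x j =
        x j := congrFun h j
      rw [← h1, Pi.single_eq_of_ne hj, map_zero, zero_mul]
    · intro h
      refine funext fun j => ?_
      change algebraMap K (Matrix (Fin (d j)) (Fin (d j)) K) ((Pi.single i 1 : ι → K) j) * x j = x j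
      by_cases hj : j = i
      · subst hj
        rw [Pi.single_eq_same, map_one, one_mul]
      · rw [h j hj, mul_zero]
  let ev : mulLeftFixed K (fun j => algebraMap K _ ((Pi.single i 1 : ι → K) j) : PiMatrix K d) →ₗ[K]
      Matrix (Fin (d i)) (Fin (d i)) K := LinearMap.proj i ∘ₗ Submodule.subtype _
  have hev : Function.Bijective ev := by
    refine ⟨fun x y hxy => Subtype.ext (funext fun j => ?_), fun m => ?_⟩
    · by_cases hj : j = i
      · subst hj
        exact hxy
      · rw [(hmem x).1 x.2 j hj, (hmem y).1 y.2 j hj]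
    · refine ⟨⟨(Pi.single i m : PiMatrix K d), (hmem _).2 fun j hj => by simp [hj]⟩, ?_⟩
      change (Pi.single i m : PiMatrix K d) i = m
      rw [Pi.single_eq_same]
  rw [(LinearEquiv.ofBijective ev hev).finrank_eq, Module.finrank_matrix, Module.finrank_self,
    mul_one, Fintype.card_fin]

theorem finrank_mulLeftFixed_algEquiv {A B : Type*} [Ring A] [Ring B] [Algebra K A] [Algebra K B]
    (F : A ≃ₐ[K] B) (a : A) :
    Module.finrank K (mulLeftFixed K (F a)) = Module.finrank K (mulLeftFixed K a) := by
  have : mulLeftFixed K (F a) = (mulLeftFixed K a).map (F.toLinearEquiv : A →ₗ[K] B) := by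
    ext y
    constructor
    · intro hy
      refine ⟨F.symm y, ?_, F.apply_symm_apply y⟩
      apply F.injective
      change F (a * F.symm y) = F (F.symm y)
      rw [map_mul, F.apply_symm_apply]
      exact hy
    · rintro ⟨x, hx, rfl⟩
      change F a * F x = F x
      rw [← map_mul]
      exact congrArg F hx
  rw [this]
  exact (F.toLinearEquiv.submoduleMap _).symm.finrank_eq

/-- Uniqueness in the Wedderburn decomposition for products of matrix algebras over a field. -/
theorem exists_equiv_iff_nonempty_piMatrix_algEquiv (hd : ∀ i, 0 < d i) (he : ∀ j, 0 < e j) :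
    (∃ φ : ι ≃ κ, ∀ i, e (φ i) = d i) ↔ Nonempty (PiMatrix K d ≃ₐ[K] PiMatrix K e) := by
  classical
  constructor
  · rintro ⟨φ, hφ⟩
    obtain rfl : e ∘ φ = d := funext hφ
    exact ⟨AlgEquiv.piCongrLeft K (fun j => Matrix (Fin (e j)) (Fin (e j)) K) φ⟩
  · rintro ⟨F⟩
    let ψ := (piMatrixCenterEquiv K hd).trans
      ((Submonoid.centerCongr F.toMulEquiv).trans (piMatrixCenterEquiv K he).symm)
    obtain ⟨φ, hφ⟩ := exists_equiv_apply_single_of_pi_mulEquiv ψ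
    refine ⟨φ, fun i => ?_⟩
    have h1 : F (fun j => algebraMap K _ ((Pi.single i 1 : ι → K) j)) =
        fun j => algebraMap K _ ((Pi.single (φ i) 1 : κ → K) j) := by
      have h2 := congrArg (piMatrixCenterEquiv K he) (hφ i)
      rw [MulEquiv.trans_apply, MulEquiv.trans_apply, MulEquiv.apply_symm_apply] at h2
      exact congrArg Subtype.val h2
    have h3 := finrank_mulLeftFixed_algEquiv F (fun j => algebraMap K _ ((Pi.single i 1 : ι → K) j))
    rw [h1, finrank_mulLeftFixed_single, finrank_mulLeftFixed_single] at h3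
    exact Nat.mul_self_inj.1 h3

end PiMatrix

-- Centers of module categories.

universe u
open CategoryTheory

/-- The center of the category of modules over a ring is the center of the ring. -/
noncomputable def ModuleCat.catCenterEquiv (A : Type u) [Ring A] :
    Submonoid.center A ≃* CatCenter (ModuleCat.{u} A) where
  toFun z :=
    { app := fun M => ModuleCat.ofHom
        { toFun := fun m => z.1 • m
          map_add' := fun x y => smul_add _ _ _
          map_smul' := fun a x => by
            rw [RingHom.id_apply, smul_smul, smul_smul, Submonoid.mem_center_iff.1 z.2 a] }
      naturality := fun M N f => by
        ext m
        exact (f.hom.map_smul z.1 m).symm }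
  -- Evaluate at 1 in the regular module; naturality along right multiplications makes the value
  -- central.
  invFun η := ⟨(η.app (ModuleCat.of A A)).hom (1 : A), by
    rw [Submonoid.mem_center_iff]
    intro a
    have h1 := congrArg (fun f => f.hom (1 : A)) (CatCenter.naturality η
      (ModuleCat.ofHom (LinearMap.toSpanSingleton A A a)))
    have h2 := (η.app (ModuleCat.of A A)).hom.map_smul a (1 : A)
    simp only [ModuleCat.hom_comp, LinearMap.comp_apply, ModuleCat.hom_ofHom,
      LinearMap.toSpanSingleton_apply, smul_eq_mul, one_mul, mul_one] at h1 h2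
    exact h2.symm.trans h1⟩
  left_inv z := Subtype.ext (mul_one z.1)
  right_inv η := by
    ext M m
    have h1 := congrArg (fun f => f.hom (1 : A)) (CatCenter.naturality η
      (ModuleCat.ofHom (LinearMap.toSpanSingleton A M m)))
    simp only [ModuleCat.hom_comp, LinearMap.comp_apply, ModuleCat.hom_ofHom,
      LinearMap.toSpanSingleton_apply, one_smul] at h1
    exact h1.symm
  map_mul' z w := by
    ext M m
    exact mul_smul z.1 w.1 m

/-- Equivalent categories have isomorphic centers. -/
noncomputable def CategoryTheory.Equivalence.catCenterMulEquiv {C D : Type*} [Category* C]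
    [Category* D] (e : C ≌ D) : CatCenter C ≃* CatCenter D :=
  -- Whiskering on either side identifies both centers with the endomorphisms of `e.functor`.
  ((e.congrRight (E := C)).fullyFaithfulFunctor.mulEquivEnd (𝟭 C)).trans
    ((Iso.conj (e.functor.leftUnitor ≪≫ e.functor.rightUnitor.symm)).trans
      ((e.symm.congrLeft (E := D)).fullyFaithfulFunctor.mulEquivEnd (𝟭 D)).symm)

theorem IsMoritaEquivalent.nonempty_center_mulEquiv {R : Type*} {A B : Type u} [CommRing R]
    [Ring A] [Ring B] [Algebra R A] [Algebra R B] (h : IsMoritaEquivalent R A B) :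
    Nonempty (Submonoid.center A ≃* Submonoid.center B) := by
  obtain ⟨⟨e⟩⟩ := h
  exact ⟨(ModuleCat.catCenterEquiv A).trans
    ((Equivalence.catCenterMulEquiv e.eqv).trans (ModuleCat.catCenterEquiv B).symm)⟩

/-! ### Morita equivalence from a bimodule. -/

open CategoryTheory TensorProduct

section TensorFunctor

variable (A B P : Type u) [Ring A] [CommRing B] [AddCommGroup P] [Module A P] [Module B P]
  [SMulCommClass B A P]

/-- Tensoring with a bimodule, as a functor between module categories. -/
noncomputable def ModuleCat.tensorBimodule : ModuleCat.{u} B ⥤ ModuleCat.{u} A where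
  obj N := ModuleCat.of A (P ⊗[B] N)
  map {N N'} g := ModuleCat.ofHom
    { LinearMap.lTensor P g.hom with
      map_smul' := fun a t => by
        change LinearMap.lTensor P g.hom (a • t) = a • LinearMap.lTensor P g.hom t
        induction t with
        | zero => simp
        | add x y hx hy => rw [smul_add, map_add, hx, hy, map_add, smul_add]
        | tmul p n => simp [TensorProduct.smul_tmul'] }
  map_id N := by
    ext t
    exact LinearMap.congr_fun (LinearMap.lTensor_id P N) t
  map_comp f g := by
    ext t
    exact LinearMap.congr_fun (LinearMap.lTensor_comp P g.hom f.hom) t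

variable {A B P} {p₀ : P} {φ₀ : P →ₗ[B] B} {c : B →+* A} {u : P → A}

/-- Contraction of the first tensor factor along a linear form. -/
noncomputable def TensorProduct.contractFirst (φ₀ : P →ₗ[B] B) (N : Type*) [AddCommGroup N]
    [Module B N] : P ⊗[B] N →ₗ[B] N :=
  (TensorProduct.lid B N).toLinearMap ∘ₗ LinearMap.rTensor N φ₀

theorem TensorProduct.contractFirst_tmul (φ₀ : P →ₗ[B] B) {N : Type*} [AddCommGroup N]
    [Module B N] (p : P) (n : N) :
    TensorProduct.contractFirst φ₀ N (p ⊗ₜ n) = φ₀ p • n := by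
  simp [TensorProduct.contractFirst]

theorem TensorProduct.smul_eq_tmul_contractFirst (hu : ∀ p q : P, u p • q = φ₀ q • p)
    {N : Type*} [AddCommGroup N] [Module B N] (p : P) (t : P ⊗[B] N) :
    u p • t = p ⊗ₜ TensorProduct.contractFirst φ₀ N t := by
  induction t with
  | zero => simp
  | add x y hx hy => rw [smul_add, hx, hy, map_add, TensorProduct.tmul_add]
  | tmul q n =>
    rw [TensorProduct.smul_tmul', hu, TensorProduct.contractFirst_tmul, TensorProduct.smul_tmul]

/-- A map g is recovered from id ⊗ g by inserting p₀ and contracting with φ₀. -/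
theorem ModuleCat.tensorBimodule_faithful (h₀ : φ₀ p₀ = 1) :
    (ModuleCat.tensorBimodule A B P).Faithful where
  map_injective {N N'} f g h := by
    ext n
    have h1 := congrArg (fun k => TensorProduct.contractFirst φ₀ N' (k.hom (p₀ ⊗ₜ[B] n))) h
    change TensorProduct.contractFirst φ₀ N' (p₀ ⊗ₜ[B] f.hom n) =
      TensorProduct.contractFirst φ₀ N' (p₀ ⊗ₜ[B] g.hom n) at h1
    simpa [TensorProduct.contractFirst_tmul, h₀] using h1

/-- Since p ⊗ n = u p • (p₀ ⊗ n), an A-linear map is determined by its values on the tensors p₀ ⊗ n;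
`c` makes it B-linear, so inserting p₀ and contracting gives the preimage. -/
theorem ModuleCat.tensorBimodule_full (h₀ : φ₀ p₀ = 1) (hc : ∀ (b : B) (q : P), c b • q = b • q)
    (hu : ∀ p q : P, u p • q = φ₀ q • p) :
    (ModuleCat.tensorBimodule A B P).Full where
  map_surjective {N N'} h := by
    have hcT {N : Type u} [AddCommGroup N] [Module B N] (b : B) (t : P ⊗[B] N) :
        c b • t = b • t := by
      induction t with
      | zero => simp
      | add x y hx hy => rw [smul_add, smul_add, hx, hy]
      | tmul q n => rw [TensorProduct.smul_tmul', TensorProduct.smul_tmul', hc]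
    let h' : P ⊗[B] N →ₗ[A] P ⊗[B] N' := h.hom
    let hB : P ⊗[B] N →ₗ[B] P ⊗[B] N' :=
      { toFun := h'
        map_add' := map_add h'
        map_smul' := fun b t => by rw [← hcT, map_smul, hcT]; rfl }
    let g : N →ₗ[B] N' := TensorProduct.contractFirst φ₀ N' ∘ₗ hB ∘ₗ TensorProduct.mk B P N p₀
    refine ⟨ModuleCat.ofHom g, ?_⟩
    refine ModuleCat.hom_ext (LinearMap.ext fun (t : P ⊗[B] N) => ?_)
    change LinearMap.lTensor P g t = h' t
    induction t with
    | zero => simp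
    | add x y hx hy => rw [map_add, map_add, hx, hy]
    | tmul p n =>
      have h1 : p ⊗ₜ[B] n = u p • (p₀ ⊗ₜ[B] n) := by
        rw [TensorProduct.smul_tmul', hu, h₀, one_smul]
      rw [LinearMap.lTensor_tmul, h1, map_smul,
        TensorProduct.smul_eq_tmul_contractFirst (φ₀ := φ₀) hu]
      rfl

/-- The operator u p₀ is a projection onto the line of p₀. A module M comes from N = u p₀ M through
p ⊗ n ↦ u p • n, with inverse m ↦ ∑ x i ⊗ w i • m because ∑ u (x i) * w i = 1. -/
theorem ModuleCat.tensorBimodule_essSurj [FaithfulSMul A P] (h₀ : φ₀ p₀ = 1)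
    (hc : ∀ (b : B) (q : P), c b • q = b • q) (hu : ∀ p q : P, u p • q = φ₀ q • p)
    {ι : Type*} [Fintype ι] (x : ι → P) (f : ι → P →ₗ[B] B) (w : ι → A)
    (hw : ∀ i q, w i • q = f i q • p₀) (hf : ∀ q, ∑ i, f i q • x i = q) :
    (ModuleCat.tensorBimodule A B P).EssSurj where
  mem_essImage M := by
    -- By faithfulness, identities in A can be checked on P.
    have ext {a a' : A} (h : ∀ q : P, a • q = a' • q) : a = a' := eq_of_smul_eq_smul h
    have hau (a : A) (p : P) : a * u p = u (a • p) := ext fun q => by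
      rw [mul_smul, hu, hu, smul_comm (φ₀ q) a p]
    have hcu (b : B) (p : P) : c b * u p = u (b • p) := by rw [hau, hc]
    have huc (b : B) (p : P) : u p * c b = u (b • p) := ext fun q => by
      rw [mul_smul, hc, hu, hu, map_smul, smul_eq_mul, mul_smul, smul_comm]
    have huadd (p q : P) : u (p + q) = u p + u q := ext fun r => by
      rw [add_smul, hu, hu, hu, smul_add]
    have huw : ∑ i, u (x i) * w i = 1 := ext fun q => by
      rw [Finset.sum_smul, one_smul]
      simp_rw [mul_smul, hw, hu, map_smul, h₀, smul_eq_mul, mul_one]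
      exact hf q
    have hwu (i : ι) (p : P) : w i * u p = c (f i p) * u p₀ := ext fun q => by
      rw [mul_smul, mul_smul, hw, hu, hu, hc, map_smul, smul_eq_mul, mul_smul, smul_comm]
    have huw0 (i : ι) : u p₀ * w i = w i := ext fun q => by
      rw [mul_smul, hw, hu, map_smul, h₀, smul_eq_mul, mul_one]
    let _ : Module B M := Module.compHom M c
    have hBM (b : B) (m : M) : b • m = c b • m := rfl
    let N : Submodule B M :=
      { carrier := {m | u p₀ • m = m}
        add_mem' := fun {m m'} (h : u p₀ • m = m) (h' : u p₀ • m' = m') =>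
          (smul_add (u p₀) m m').trans (congrArg₂ _ h h')
        zero_mem' := smul_zero _
        smul_mem' := fun b m (h : u p₀ • m = m) => by
          change u p₀ • c b • m = c b • m
          rw [smul_smul, huc, ← hcu, mul_smul, h] }
    have hN (n : N) : u p₀ • (n : M) = n := n.2
    let F₀ : P →ₗ[B] N →ₗ[B] M := LinearMap.mk₂ B (fun p n => u p • (n : M))
      (fun p q n => by rw [huadd, add_smul])
      (fun b p n => by rw [← hcu, mul_smul]; rfl)
      (fun p n n' => by rw [Submodule.coe_add, smul_add])
      (fun b p n => by rw [Submodule.coe_smul, hBM, hBM, smul_smul, smul_smul, huc, hcu])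
    let F : P ⊗[B] N →ₗ[A] M :=
      { TensorProduct.lift F₀ with
        map_smul' := fun a t => by
          change TensorProduct.lift F₀ (a • t) = a • TensorProduct.lift F₀ t
          induction t with
          | zero => simp
          | add x y hx hy => rw [smul_add, map_add, hx, hy, map_add, smul_add]
          | tmul p n =>
            rw [TensorProduct.smul_tmul', TensorProduct.lift.tmul, TensorProduct.lift.tmul]
            change u (a • p) • (n : M) = a • u p • (n : M)
            rw [← hau, mul_smul] }
    have hwN (i : ι) (m : M) : w i • m ∈ N := by
      change u p₀ • w i • m = w i • m
      rw [smul_smul, huw0]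
    let G : M →+ P ⊗[B] N :=
      { toFun := fun m => ∑ i, x i ⊗ₜ[B] (⟨w i • m, hwN i m⟩ : N)
        map_zero' := Finset.sum_eq_zero fun i _ => by
          rw [show (⟨w i • 0, hwN i 0⟩ : N) = 0 from Subtype.ext (smul_zero _),
            TensorProduct.tmul_zero]
        map_add' := fun m m' => by
          rw [← Finset.sum_add_distrib]
          refine Finset.sum_congr rfl fun i _ => ?_
          rw [← TensorProduct.tmul_add]
          exact congrArg _ (Subtype.ext (smul_add _ _ _)) }
    have hFG (m : M) : F (G m) = m := by
      change F (∑ i, x i ⊗ₜ[B] (⟨w i • m, hwN i m⟩ : N)) = m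
      rw [map_sum]
      calc ∑ i, u (x i) • w i • m = (∑ i, u (x i) * w i) • m := by
            rw [Finset.sum_smul]
            exact Finset.sum_congr rfl fun i _ => (mul_smul _ _ _).symm
        _ = m := by rw [huw, one_smul]
    have hGF (t : P ⊗[B] N) : G (F t) = t := by
      induction t with
      | zero => rw [map_zero, map_zero]
      | add x y hx hy => rw [map_add, map_add, hx, hy]
      | tmul p n =>
        have h1 (i : ι) : (⟨w i • u p • (n : M), hwN i _⟩ : N) = f i p • n := Subtype.ext (by
          change w i • u p • (n : M) = c (f i p) • (n : M)
          rw [smul_smul, hwu, mul_smul, hN])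
        calc ∑ i, x i ⊗ₜ[B] (⟨w i • u p • (n : M), hwN i _⟩ : N)
            = ∑ i, (f i p • x i) ⊗ₜ[B] n := Finset.sum_congr rfl fun i _ => by
              rw [h1, TensorProduct.smul_tmul]
          _ = p ⊗ₜ[B] n := by rw [← TensorProduct.sum_tmul, hf]
    exact ⟨ModuleCat.of B N, ⟨(LinearEquiv.ofBijective F
      ⟨Function.LeftInverse.injective hGF, Function.RightInverse.surjective hFG⟩).toModuleIso⟩⟩

open scoped ModuleCat.Algebra in
theorem ModuleCat.tensorBimodule_linear {K : Type*} [CommRing K] [Algebra K A] [Algebra K B]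
    (hK : ∀ (r : K) (p : P), algebraMap K A r • p = algebraMap K B r • p) :
    (ModuleCat.tensorBimodule A B P).Linear K where
  map_smul {N N'} g r := by
    let L : P ⊗[B] N →ₗ[A] P ⊗[B] N' := ((ModuleCat.tensorBimodule A B P).map (r • g)).hom
    let L' : P ⊗[B] N →ₗ[A] P ⊗[B] N' := (r • (ModuleCat.tensorBimodule A B P).map g).hom
    refine ModuleCat.hom_ext (LinearMap.ext fun (t : P ⊗[B] N) => ?_)
    change L t = L' t
    induction t with
    | zero => rw [map_zero, map_zero]
    | add x y hx hy => rw [map_add, map_add, hx, hy]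
    | tmul p n =>
      change p ⊗ₜ[B] (algebraMap K B r • g.hom n) =
        algebraMap K A r • (p ⊗ₜ[B] g.hom n : P ⊗[B] N')
      rw [TensorProduct.smul_tmul', hK, TensorProduct.smul_tmul]

/-- A faithful bimodule over `A` and a commutative ring `B` with a dual basis over `B`, a
`B`-linear form taking the value one, and enough rank-one operators in `A`, gives a Morita
equivalence. -/
theorem IsMoritaEquivalent.of_bimodule {K : Type*} [CommRing K] [Algebra K A] [Algebra K B]
    [FaithfulSMul A P] (hK : ∀ (r : K) (p : P), algebraMap K A r • p = algebraMap K B r • p)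
    (h₀ : φ₀ p₀ = 1)
    (hc : ∀ (b : B) (q : P), c b • q = b • q) (hu : ∀ p q : P, u p • q = φ₀ q • p)
    {ι : Type*} [Fintype ι] (x : ι → P) (f : ι → P →ₗ[B] B) (w : ι → A)
    (hw : ∀ i q, w i • q = f i q • p₀) (hf : ∀ q, ∑ i, f i q • x i = q) :
    IsMoritaEquivalent K B A := by
  have := ModuleCat.tensorBimodule_faithful (A := A) h₀
  have := ModuleCat.tensorBimodule_full h₀ hc hu
  have := ModuleCat.tensorBimodule_essSurj h₀ hc hu x f w hw hf
  have : (ModuleCat.tensorBimodule A B P).IsEquivalence := { }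
  exact ⟨⟨{ eqv := (ModuleCat.tensorBimodule A B P).asEquivalence
            linear := ModuleCat.tensorBimodule_linear hK }⟩⟩

end TensorFunctor

/-! ### Morita classes of products of matrix algebras. -/

section PiMatrixMorita

open scoped Matrix.Module

variable {K ι : Type u} [Field K] [Fintype ι] {d : ι → ℕ}

open scoped Classical in
/-- A finite product of nonzero matrix algebras over a field is Morita equivalent to a power of
the field. -/
theorem isMoritaEquivalent_piMatrix (hd : ∀ i, 0 < d i) :
    IsMoritaEquivalent K (ι → K) (PiMatrix K d) := by
  let P := ∀ i, Fin (d i) → K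
  let z (i : ι) : Fin (d i) := ⟨0, hd i⟩
  have hA (a : PiMatrix K d) (p : P) (i : ι) (k : Fin (d i)) :
      (a • p) i k = ∑ j, a i k j * p i j := rfl
  have hB (b : ι → K) (p : P) (i : ι) (k : Fin (d i)) : (b • p) i k = b i * p i k := rfl
  have hcomm : SMulCommClass (ι → K) (PiMatrix K d) P := ⟨fun b a p => by
    ext i k
    rw [hA, hB, hA, Finset.mul_sum]
    exact Finset.sum_congr rfl fun j _ => by rw [hB, mul_left_comm]⟩
  have hfaith : FaithfulSMul (PiMatrix K d) P := ⟨fun {a a'} h => by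
    ext i j k
    have := congrFun (congrFun (h (Pi.single i (Pi.single k 1))) i) j
    rw [hA, hA] at this
    simpa [Pi.single_apply] using this⟩
  -- P consists of column vectors: p₀ is the first basis vector of every block, φ₀ the first
  -- coordinates, u p the matrices with first column p and zeros elsewhere, x and f the standard
  -- dual bases, w the matrix units in the first row.
  refine IsMoritaEquivalent.of_bimodule (P := P) (p₀ := fun i => Pi.single (z i) 1)
    (φ₀ := { toFun := fun q i => q i (z i), map_add' := fun _ _ => rfl,
             map_smul' := fun _ _ => rfl })
    (c := RingHom.pi fun i => (algebraMap K (Matrix (Fin (d i)) (Fin (d i)) K)).comp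
      (Pi.evalRingHom _ i))
    (u := fun p i => Matrix.of fun a b => if b = z i then p i a else 0)
    (ι := Σ i, Fin (d i))
    (x := fun s => Pi.single s.1 (Pi.single s.2 1))
    (f := fun s => { toFun := fun q => Pi.single s.1 (q s.1 s.2)
                     map_add' := fun p q => Pi.single_add _ _ _
                     map_smul' := fun b q => by
                      ext i
                      by_cases h : i = s.1
                      · subst h; simp [hB]
                      · simp [h] })
    (w := fun s => Pi.single s.1 (Matrix.single (z s.1) s.2 1)) ?_ ?_ ?_ ?_ ?_ ?_
  · intro r p
    ext i k
    rw [hA, hB]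
    simp [Matrix.algebraMap_matrix_apply]
  · ext i
    simp
  · intro b q
    ext i k
    rw [hA, hB]
    simp [Matrix.algebraMap_matrix_apply]
  · intro p q
    ext i k
    rw [hA, hB]
    simp [mul_comm]
  · rintro ⟨i, a⟩ q
    ext j k
    rw [hA, hB]
    by_cases h : j = i
    · subst h
      by_cases hk : z j = k
      · simp [Matrix.single_apply, hk]
      · simp [hk, Ne.symm hk]
    · simp [h]
  · intro q
    ext i k
    rw [Finset.sum_apply, Finset.sum_apply, Fintype.sum_sigma, Fintype.sum_eq_single i]
    · simp [hB, Pi.single_apply]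
    · intro j hj
      simp [hB, hj.symm]

variable {κ : Type u} [Fintype κ] {e : κ → ℕ}

/-- Two finite products of nonzero matrix algebras over a field are Morita equivalent if and only
if they have the same number of factors. -/
theorem isMoritaEquivalent_piMatrix_iff (hd : ∀ i, 0 < d i) (he : ∀ j, 0 < e j) :
    IsMoritaEquivalent K (PiMatrix K d) (PiMatrix K e) ↔ Fintype.card ι = Fintype.card κ := by
  classical
  constructor
  · intro h
    -- The centers are powers of K, whose primitive idempotents count the factors.
    obtain ⟨ψ⟩ := h.nonempty_center_mulEquiv
    obtain ⟨φ, -⟩ := exists_equiv_apply_single_of_pi_mulEquiv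
      ((piMatrixCenterEquiv K hd).trans (ψ.trans (piMatrixCenterEquiv K he).symm))
    exact Fintype.card_congr φ
  · intro h
    let φ := Fintype.equivOfCardEq h
    exact (isMoritaEquivalent_piMatrix hd).symm.trans K
      ((IsMoritaEquivalent.of_algEquiv K (AlgEquiv.piCongrLeft K (fun _ : κ => K) φ)).trans K
        (isMoritaEquivalent_piMatrix he))

end PiMatrixMorita

/-! ### Assembly of the theorem. -/

theorem exists_invariantAlgebra_algEquiv_piMatrix {R : Type*} [Field R] [IsAlgClosed R] {n : ℕ}
    (σ : Equiv.Perm (Fin n)) (h : ∀ a ∈ σ.partition.parts, (a : R) ≠ 0) :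
    Nonempty (invariantAlgebra R σ ≃ₐ[R] PiMatrix R (eigenDim R σ)) := by
  obtain ⟨F⟩ := Module.End.exists_centralizer_algEquiv_pi_matrix
    (isSemisimple_funLeft σ h).iSup_eigenspace_eq_top
  exact ⟨(invariantAlgebraEquivCentralizer σ).trans F⟩

theorem theorem1p1 {R : Type*} [Field R] (p : ℕ) [CharP R p] (n m : ℕ) (hn : 0 < n) (hm : 0 < m)
    (σ : Equiv.Perm (Fin n)) (τ : Equiv.Perm (Fin m)) :
    (IsSemisimpleRing (invariantAlgebra R σ) ↔ ∀ a ∈ σ.partition.parts, ¬ p ∣ a) ∧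
    (IsAlgClosed R → (∀ a ∈ σ.partition.parts, ¬ p ∣ a) → (∀ b ∈ τ.partition.parts, ¬ p ∣ b) →
      (Nonempty (invariantAlgebra R σ ≃ₐ[R] invariantAlgebra R τ) ↔
        m = n ∧ σ.partition.partitionPolynomial = τ.partition.partitionPolynomial) ∧
      (IsMoritaEquivalent R (invariantAlgebra R σ) (invariantAlgebra R τ) ↔
        (-1) ^ (σ.partition.numParts - 1) * (σ.partition.gcdParts : ℤ) *
            σ.partition.partitionPolynomial.eval 1 =
          (-1) ^ (τ.partition.numParts - 1) * (τ.partition.gcdParts : ℤ) *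
            τ.partition.partitionPolynomial.eval 1)) := by
  -- Non-divisibility by p becomes nonvanishing in R, which covers p = 0 as well.
  simp only [← CharP.cast_eq_zero_iff R p]
  refine ⟨⟨fun _ a ha => natCast_ne_zero_of_isSemisimpleRing σ ha,
    isSemisimpleRing_invariantAlgebra σ⟩, fun _ hσ hτ => ?_⟩
  obtain ⟨F⟩ := exists_invariantAlgebra_algEquiv_piMatrix σ hσ
  obtain ⟨G⟩ := exists_invariantAlgebra_algEquiv_piMatrix τ hτ
  constructor
  · have hpi : Nonempty (invariantAlgebra R σ ≃ₐ[R] invariantAlgebra R τ) ↔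
        Nonempty (PiMatrix R (eigenDim R σ) ≃ₐ[R] PiMatrix R (eigenDim R τ)) :=
      ⟨fun ⟨H⟩ => ⟨F.symm.trans (H.trans G)⟩, fun ⟨H⟩ => ⟨F.trans (H.trans G.symm)⟩⟩
    rw [hpi, ← exists_equiv_iff_nonempty_piMatrix_algEquiv (eigenDim_pos σ) (eigenDim_pos τ),
      exists_equiv_iff_sum_choose_eq (eigenDim_pos σ) (eigenDim_pos τ)]
    have hg := Nat.Partition.gcdEsymm_eq_iff (l := σ.partition) (l' := τ.partition)
      (by rwa [Fintype.card_fin]) (by rwa [Fintype.card_fin])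
    -- `σ.partition` is a partition of `Fintype.card (Fin n)`, so the sizes are compared in that
    -- form.
    rw [show m = n ↔ Fintype.card (Fin m) = Fintype.card (Fin n) by simp, ← hg]
    refine forall₂_congr fun k hk => ?_
    rw [sum_choose_eigenDim σ hσ hk, sum_choose_eigenDim τ hτ hk]
  · have hpi : IsMoritaEquivalent R (invariantAlgebra R σ) (invariantAlgebra R τ) ↔
        IsMoritaEquivalent R (PiMatrix R (eigenDim R σ)) (PiMatrix R (eigenDim R τ)) :=
      ⟨fun H => (IsMoritaEquivalent.of_algEquiv R F.symm).trans R
          (H.trans R (IsMoritaEquivalent.of_algEquiv R G)),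
        fun H => (IsMoritaEquivalent.of_algEquiv R F).trans R
          (H.trans R (IsMoritaEquivalent.of_algEquiv R G.symm))⟩
    rw [hpi, isMoritaEquivalent_piMatrix_iff (eigenDim_pos σ) (eigenDim_pos τ),
      ← card_eigenvalues σ hσ, ← card_eigenvalues τ hτ, Nat.cast_inj]
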